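/- **Setting.** Consider the system $\dot x=f(x)+g(x)u$ with state $x\in\mathbb{R}^n$ and input $u\in\mathbb{R}^m$, where $f:\mathbb{R}^n\to\mathbb{R}^n$ and $g:\mathbb{R}^n\to\mathbb{R}^{n\times m}$ are polynomial and $f(0)=0$, and the running cost $r(x,u)=q(x)+u^TR(x)u$, where $q$ is a positive definite polynomial and $R(x)$ is a matrix of polynomials that is symmetric positive definite for every $x$. Let $\mathcal{P}$ be the set of $C^1$ functions $V:\mathbb{R}^n\to\mathbb{R}$ that are positive definite and proper. A feedback control policy is a continuous map $u:\mathbb{R}^n\to\mathbb{R}^m$; it is *globally stabilizing* if the closed-loop system $\dot x=f(x)+g(x)u(x)$ is globally asymptotically stable at the origin: the origin is an equilibrium, a solution on $[0,\infty)$ starts at each state, every solution on a bounded interval $[0,T)$ continues to $[0,\infty)$, the origin is Lyapunov stable, and every solution on $[0,\infty)$ tends to $0$ (solutions need not be unique, and all of them are meant). For $V\in C^1$ put $$\mathcal{L}(V,u)=-\nabla V^T(f+gu)-r(x,u),\qquad \mathcal{H}(V)=\nabla V^Tf+q-\tfrac14\nabla V^TgR^{-1}g^T\nabla V .$$ **Theorem.**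 Suppose that * there are $V_0\in\mathcal{P}$ and a feedback control policy $u_1$ with $\mathcal{L}(V_0,u_1)\ge 0$ on $\mathbb{R}^n$; * there is $V^{\rm o}\in\mathcal{P}$ with $\mathcal{H}(V^{\rm o})=0$ on $\mathbb{R}^n$; put $u^{\rm o}=-\frac12R^{-1}g^T\nabla V^{\rm o}$; * for $i=1,2,\dots$ there are $V_i\in C^1$ with $V_i(0)=0$ and $\mathcal{L}(V_i,u_i)=0$ on $\mathbb{R}^n$, where $u_{i+1}=-\frac12R^{-1}g^T\nabla V_i$. Then: 1. $V^{\rm o}(x)\le V_{i+1}(x)\le V_i(x)$ for all $x\in\mathbb{R}^n$ and all $i=0,1,2,\dots$; 2. $u_{i+1}$ is globally stabilizing for all $i=0,1,2,\dots$; 3. if $V^*\in C^1$ and $u^*:\mathbb{R}^n\to\mathbb{R}^m$ are such that $V_i(x)\to V^*(x)$ and $u_i(x)\to u^*(x)$ for every $x\in\mathbb{R}^n$, then $V^*=V^{\rm o}$, and $u^*(x)=u^{\rm o}(x)$ at every $x$ at which $u^*$ is continuous; in particular $u^*=u^{\rm o}$ if $u^*$ is a (continuous) feedback control policy. -/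

import Mathlib

open Set Filter Topology
open scoped Matrix

noncomputable section

/-- The state space `ℝⁿ` with its Euclidean structure. -/
abbrev State (n : ℕ) : Type := EuclideanSpace ℝ (Fin n)

/-- The control space `ℝᵐ`. -/
abbrev Control (m : ℕ) : Type := Fin m → ℝ

/-- A polynomial optimal control problem: the dynamics `ẋ = f(x) + g(x) u` with polynomial `f`, `g`
and `f(0) = 0`, and the running cost `r(x,u) = q(x) + uᵀ R(x) u` with a positive definite
polynomial `q` and a polynomial matrix `R` that is symmetric positive definite at every state. -/
structure PolyControlProblem (n m : ℕ) where
  f : Fin n → MvPolynomial (Fin n) ℝ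
  g : Matrix (Fin n) (Fin m) (MvPolynomial (Fin n) ℝ)
  q : MvPolynomial (Fin n) ℝ
  R : Matrix (Fin m) (Fin m) (MvPolynomial (Fin n) ℝ)
  f_zero : ∀ j, MvPolynomial.eval (0 : Fin n → ℝ) (f j) = 0
  q_zero : MvPolynomial.eval (0 : Fin n → ℝ) q = 0
  q_pos : ∀ x : Fin n → ℝ, x ≠ 0 → 0 < MvPolynomial.eval x q
  R_posDef : ∀ x : Fin n → ℝ, (R.map (MvPolynomial.eval x)).PosDef

/-- The class `𝒫` of continuously differentiable, positive definite and proper functions (for a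
positive definite function, proper means radially unbounded). -/
structure IsClassP {n : ℕ} (V : State n → ℝ) : Prop where
  contDiff : ContDiff ℝ 1 V
  map_zero : V 0 = 0
  pos : ∀ x, x ≠ 0 → 0 < V x
  proper : Tendsto V (cocompact (State n)) atTop

/-- `x` is a solution of `ẋ = F(x)` on the interval `I` (one-sided derivatives at endpoints
belonging to `I`). -/
def IsSolutionOn {n : ℕ} (F : State n → State n) (x : ℝ → State n) (I : Set ℝ) : Prop :=
  ∀ t ∈ I, HasDerivWithinAt x (F (x t)) I t

/-- Global asymptotic stability at the origin of `ẋ = F(x)`. Solutions need not be unique, so every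
requirement is imposed on all of them. -/
structure IsGloballyAsymptoticallyStable {n : ℕ} (F : State n → State n) : Prop where
  /-- the origin is an equilibrium -/
  equilibrium : F 0 = 0
  /-- a solution on `[0, ∞)` starts at each state -/
  exists_solution : ∀ x₀ : State n, ∃ x : ℝ → State n, x 0 = x₀ ∧ IsSolutionOn F x (Ici 0)
  /-- no finite escape: a solution on a bounded interval `[0, T)` continues to `[0, ∞)` -/
  complete : ∀ T : ℝ, 0 < T → ∀ x : ℝ → State n, IsSolutionOn F x (Ico 0 T) →
    ∃ y : ℝ → State n, EqOn y x (Ico 0 T) ∧ IsSolutionOn F y (Ici 0)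
  /-- Lyapunov stability -/
  stable : ∀ ε : ℝ, 0 < ε → ∃ δ : ℝ, 0 < δ ∧ ∀ x : ℝ → State n, IsSolutionOn F x (Ici 0) →
    ‖x 0‖ < δ → ∀ t : ℝ, 0 ≤ t → ‖x t‖ < ε
  /-- global attractivity -/
  attractive : ∀ x : ℝ → State n, IsSolutionOn F x (Ici 0) → Tendsto x atTop (𝓝 0)

namespace PolyControlProblem

variable {n m : ℕ} (S : PolyControlProblem n m)

/-- The vector `f(x)`. -/
def fAt (x : State n) : State n := WithLp.toLp 2 fun j => MvPolynomial.eval x.ofLp (S.f j)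

/-- The matrix `g(x)`. -/
def gAt (x : State n) : Matrix (Fin n) (Fin m) ℝ := S.g.map (MvPolynomial.eval x.ofLp)

/-- The number `q(x)`. -/
def qAt (x : State n) : ℝ := MvPolynomial.eval x.ofLp S.q

/-- The matrix `R(x)`. -/
def RAt (x : State n) : Matrix (Fin m) (Fin m) ℝ := S.R.map (MvPolynomial.eval x.ofLp)

/-- The right-hand side `f(x) + g(x) v`. -/
def dynamics (x : State n) (v : Control m) : State n :=
  S.fAt x + WithLp.toLp 2 (S.gAt x *ᵥ v)

/-- The running cost `r(x,v) = q(x) + vᵀ R(x) v`. -/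
def runningCost (x : State n) (v : Control m) : ℝ := S.qAt x + v ⬝ᵥ (S.RAt x *ᵥ v)

/-- `ℒ(V,u)(x) = -∇V(x)ᵀ (f(x) + g(x) u(x)) - r(x,u(x))`. -/
def opL (V : State n → ℝ) (u : State n → Control m) (x : State n) : ℝ :=
  -inner ℝ (gradient V x) (S.dynamics x (u x)) - S.runningCost x (u x)

/-- `ℋ(V)(x) = ∇V(x)ᵀ f(x) + q(x) - ¼ ∇V(x)ᵀ g(x) R(x)⁻¹ g(x)ᵀ ∇V(x)`. -/
def opH (V : State n → ℝ) (x : State n) : ℝ :=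
  inner ℝ (gradient V x) (S.fAt x) + S.qAt x
    - 1 / 4 * ((gradient V x).ofLp ⬝ᵥ
        (S.gAt x *ᵥ ((S.RAt x)⁻¹ *ᵥ ((S.gAt x)ᵀ *ᵥ (gradient V x).ofLp))))

/-- The feedback `x ↦ -½ R(x)⁻¹ g(x)ᵀ ∇V(x)`. -/
def improvedPolicy (V : State n → ℝ) (x : State n) : Control m :=
  -((1 / 2 : ℝ) • ((S.RAt x)⁻¹ *ᵥ ((S.gAt x)ᵀ *ᵥ (gradient V x).ofLp)))

/-- The feedback `u` is globally stabilizing: the closed loop `ẋ = f(x) + g(x) u(x)` is globally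
asymptotically stable at the origin. -/
def GloballyStabilizing (u : State n → Control m) : Prop :=
  IsGloballyAsymptoticallyStable fun x => S.dynamics x (u x)

end PolyControlProblem

end

/-! Everything rests on completing the square (`opL_eq`): ℒ(V,u) = -ℋ(V) - |u - u_V|², with the norm
weighted by R(x) and u_V the improved policy of V. Along the closed loop of u, V has derivative
-ℒ(V,u) - r(x,u). So ℒ(V,u) ≥ 0 with V in 𝒫 makes V a strict Lyapunov function, and along a
stabilizing u an inequality between ℒ(V,u) and ℒ(W,u) integrates to one between V and W
(`le_of_opL_le`). Since ℒ(Vᵒ,·) ≤ 0 = ℒ(V_i,u_i) and ℒ(V_i,u_{i+1}) = -ℋ(V_i) ≥ 0, induction yields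
claims 1 and 2. The closed loops are merely continuous, so Peano's theorem supplies the solutions.

For claim 3 no convergence of gradients is given. By Baire, the u_i converge locally uniformly at
the points of a dense set. There, for each fixed control value w, the derivative of V_i along f + gw
is quadratic in u_i and u_{i+1}, hence converges locally uniformly; integrating along a solution
identifies the limit as the derivative of V*. Varying w gives ℋ(V*) = 0 and the formula for u* on
the dense set. Continuity extends the HJB equation to all states; comparison along uᵒ then gives V*
≤ Vᵒ, and claim 1 gives the reverse. -/

/-! ### Peano existence by Euler's scheme. -/

section Peano

variable {E : Type*} [NormedAddCommGroup E] [NormedSpace ℝ E]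

/-- The nodes of the explicit Euler scheme with step `h` started at `x₀`. -/
noncomputable def eulerNode (F : E → E) (h : ℝ) (x₀ : E) (j : ℕ) : E := (fun y => y + h • F y)^[j] x₀

theorem eulerNode_succ (F : E → E) (h : ℝ) (x₀ : E) (j : ℕ) :
    eulerNode F h x₀ (j + 1) = eulerNode F h x₀ j + h • F (eulerNode F h x₀ j) :=
  Function.iterate_succ_apply' _ _ _

/-- Each step adds h • F, which is within hε of h • c. With c = 0 this bounds the displacement; with
c a value of F it leads to the derivative. -/
theorem norm_eulerNode_sub_le {F : E → E} {h ε : ℝ} (hh : 0 ≤ h) {x₀ c : E} (i l : ℕ)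
    (hF : ∀ k < l, ‖F (eulerNode F h x₀ (i + k)) - c‖ ≤ ε) :
    ‖eulerNode F h x₀ (i + l) - eulerNode F h x₀ i - (l * h) • c‖ ≤ l * h * ε := by
  induction l with
  | zero => simp
  | succ l ih =>
    have h1 := ih fun k hk => hF k (hk.trans l.lt_succ_self)
    have h2 := mul_le_mul_of_nonneg_left (hF l l.lt_succ_self) hh
    have e : eulerNode F h x₀ (i + (l + 1)) - eulerNode F h x₀ i - ((l + 1 : ℕ) * h) • c
        = (eulerNode F h x₀ (i + l) - eulerNode F h x₀ i - (l * h) • c)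
          + h • (F (eulerNode F h x₀ (i + l)) - c) := by
      rw [← add_assoc, eulerNode_succ]
      push_cast
      module
    rw [e]
    refine (norm_add_le _ _).trans ?_
    rw [norm_smul, Real.norm_of_nonneg hh]
    push_cast
    linarith

/-- The piecewise constant interpolation of the Euler scheme with step `1 / (k + 1)`. -/
noncomputable def eulerCurve (F : E → E) (x₀ : E) (k : ℕ) (t : ℝ) : E :=
  eulerNode F (1 / (k + 1)) x₀ ⌊t * (k + 1)⌋₊

/-- The number of steps between a and b differs from (b - a)(k + 1) by at most one, whence the terms
in 1/(k + 1), which vanish in the limit. The hypothesis `hδ` and the speed bound M keep the visited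
nodes within δ of p, where F is close to c. -/
theorem norm_eulerCurve_sub_le {F : E → E} {M ε δ : ℝ} (hM : ∀ y, ‖F y‖ ≤ M) {x₀ c p : E}
    (hF : ∀ y, ‖y - p‖ < δ → ‖F y - c‖ ≤ ε) (hε : 0 ≤ ε) (k : ℕ) {a b : ℝ} (ha : 0 ≤ a)
    (hab : a ≤ b) (hδ : ‖eulerCurve F x₀ k a - p‖ + (b - a + 1 / (k + 1)) * M < δ) :
    ‖eulerCurve F x₀ k b - eulerCurve F x₀ k a - (b - a) • c‖
      ≤ (b - a + 1 / (k + 1)) * ε + 1 / (k + 1) * ‖c‖ := by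
  have hM0 : 0 ≤ M := (norm_nonneg _).trans (hM 0)
  have hk : (0 : ℝ) < k + 1 := by positivity
  set h : ℝ := 1 / (k + 1) with hh
  have hh0 : 0 < h := by positivity
  have hhk : h * (k + 1) = 1 := by rw [hh]; field_simp
  unfold eulerCurve at hδ ⊢
  rw [← hh] at hδ ⊢
  set i := ⌊a * (k + 1)⌋₊ with hi
  obtain ⟨l, hl⟩ : ∃ l, ⌊b * (k + 1)⌋₊ = i + l :=
    Nat.exists_eq_add_of_le (Nat.floor_le_floor (by gcongr))
  have hb : 0 ≤ b := ha.trans hab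
  have a1 : (i : ℝ) ≤ a * (k + 1) := Nat.floor_le (by positivity)
  have a2 : a * (k + 1) < i + 1 := Nat.lt_floor_add_one _
  have b1 : ((i + l : ℕ) : ℝ) ≤ b * (k + 1) := hl ▸ Nat.floor_le (by positivity)
  have b2 : b * (k + 1) < (i + l : ℕ) + 1 := hl ▸ Nat.lt_floor_add_one _
  push_cast at b1 b2
  have l1 : l * h ≤ b - a + h := by
    have : (l : ℝ) ≤ (b - a) * (k + 1) + 1 := by linarith
    have := mul_le_mul_of_nonneg_right this hh0.le
    nlinarith
  have l2 : b - a - h ≤ l * h := by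
    have : (b - a) * (k + 1) - 1 ≤ (l : ℝ) := by linarith
    have := mul_le_mul_of_nonneg_right this hh0.le
    nlinarith
  rw [hl]
  have key := norm_eulerNode_sub_le hh0.le (ε := ε) (c := c) (F := F) (x₀ := x₀) i l (by
    intro j hj
    apply hF
    have hd := norm_eulerNode_sub_le hh0.le (ε := M) (c := 0) (F := F) (x₀ := x₀) i j
      (fun _ _ => by simpa using hM _)
    rw [smul_zero, sub_zero] at hd
    have : j * h * M ≤ (b - a + h) * M := by
      have : (j : ℝ) ≤ l := by exact_mod_cast hj.le
      gcongr
      exact (mul_le_mul_of_nonneg_right this hh0.le).trans l1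
    calc _ ≤ ‖eulerNode F h x₀ (i + j) - eulerNode F h x₀ i‖ + ‖eulerNode F h x₀ i - p‖ :=
          norm_sub_le_norm_sub_add_norm_sub _ _ _
      _ < δ := by linarith)
  have e : eulerNode F h x₀ (i + l) - eulerNode F h x₀ i - (b - a) • c
      = (eulerNode F h x₀ (i + l) - eulerNode F h x₀ i - (l * h) • c)
        + (l * h - (b - a)) • c := by module
  rw [e]
  refine (norm_add_le _ _).trans (add_le_add (key.trans (by gcongr)) ?_)
  rw [norm_smul]
  gcongr
  rw [Real.norm_eq_abs, abs_le]
  constructor <;> linarith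

/-- **Peano existence theorem**, in a global form for bounded continuous vector fields. -/
theorem exists_solution_of_continuous_of_bounded [ProperSpace E] {F : E → E} (hF : Continuous F)
    {M : ℝ} (hM : ∀ y, ‖F y‖ ≤ M) (x₀ : E) :
    ∃ x : ℝ → E, x 0 = x₀ ∧ ∀ t ∈ Ici (0 : ℝ), HasDerivWithinAt x (F (x t)) (Ici 0) t := by
  have hM0 : 0 ≤ M := (norm_nonneg _).trans (hM 0)
  -- Limits are taken along a nonprincipal ultrafilter: at each time the Euler values lie in a
  -- compact ball, so they converge without extracting subsequences.
  have hstep : Tendsto (fun k : ℕ => 1 / ((k : ℝ) + 1)) (hyperfilter ℕ) (𝓝 0) :=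
    tendsto_one_div_add_atTop_nhds_zero_nat.mono_left Nat.hyperfilter_le_atTop
  have hzero : ∀ k, eulerCurve F x₀ k 0 = x₀ := fun k => by simp [eulerCurve, eulerNode]
  have hlim : ∀ t : ℝ, ∃ p, 0 ≤ t →
      Tendsto (fun k => eulerCurve F x₀ k t) (hyperfilter ℕ) (𝓝 p) := by
    intro t
    by_cases ht : 0 ≤ t
    · have hb : ∀ k, eulerCurve F x₀ k t ∈ Metric.closedBall x₀ ((t + 1) * M) := by
        intro k
        have h1 := norm_eulerCurve_sub_le (x₀ := x₀) (c := 0) (p := x₀) hM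
          (δ := (t - 0 + 1 / (k + 1)) * M + 1) (fun y _ => by simpa using hM y) hM0 k le_rfl ht
          (by simp [hzero])
        rw [hzero, smul_zero, sub_zero, norm_zero, mul_zero, add_zero, sub_zero] at h1
        rw [mem_closedBall_iff_norm]
        refine h1.trans ?_
        gcongr
        rw [div_le_one (by positivity)]
        linarith [(Nat.cast_nonneg k : (0 : ℝ) ≤ k)]
      obtain ⟨p, -, hp⟩ := (isCompact_closedBall x₀ ((t + 1) * M)).ultrafilter_le_nhds
        ((hyperfilter ℕ).map fun k => eulerCurve F x₀ k t)
        (le_principal_iff.2 (Filter.mem_map.2 (Filter.univ_mem' hb)))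
      exact ⟨p, fun _ => hp⟩
    · exact ⟨0, fun h => absurd h ht⟩
  choose x hx using hlim
  have key : ∀ (a b : ℝ) (c : E) (ε δ : ℝ), 0 ≤ a → a ≤ b → 0 ≤ ε →
      (∀ y, ‖y - x a‖ < δ → ‖F y - c‖ ≤ ε) → (b - a) * M < δ →
      ‖x b - x a - (b - a) • c‖ ≤ (b - a) * ε := by
    intro a b c ε δ ha hab hε hFc hδ
    have hxa := hx a ha
    have hxb := hx b (ha.trans hab)
    have hev : ∀ᶠ k in (hyperfilter ℕ : Filter ℕ),
        ‖eulerCurve F x₀ k a - x a‖ + (b - a + 1 / ((k : ℝ) + 1)) * M < δ := by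
      have : Tendsto (fun k : ℕ => ‖eulerCurve F x₀ k a - x a‖ + (b - a + 1 / ((k : ℝ) + 1)) * M)
          (hyperfilter ℕ) (𝓝 (‖x a - x a‖ + (b - a + 0) * M)) :=
        (hxa.sub_const _).norm.add ((hstep.const_add _).mul_const _)
      exact this.eventually_lt_const (by simpa using hδ)
    have hr : Tendsto (fun k : ℕ => (b - a + 1 / ((k : ℝ) + 1)) * ε + 1 / ((k : ℝ) + 1) * ‖c‖)
        (hyperfilter ℕ) (𝓝 ((b - a + 0) * ε + 0 * ‖c‖)) :=
      ((hstep.const_add _).mul_const _).add (hstep.mul_const _)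
    rw [add_zero, zero_mul, add_zero] at hr
    refine le_of_tendsto_of_tendsto ((hxb.sub hxa).sub_const _).norm hr ?_
    filter_upwards [hev] with k hk
    exact norm_eulerCurve_sub_le hM hFc hε k ha hab hk
  have hLip : ∀ a b, 0 ≤ a → a ≤ b → ‖x b - x a‖ ≤ (b - a) * M := fun a b ha hab => by
    simpa using key a b 0 M ((b - a) * M + 1) ha hab hM0 (fun y _ => by simpa using hM y)
      (by linarith)
  refine ⟨x, tendsto_nhds_unique (hx 0 le_rfl) (by simp [hzero]), fun t ht => ?_⟩
  rw [hasDerivWithinAt_iff_isLittleO, Asymptotics.isLittleO_iff]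
  intro ε hε
  obtain ⟨δ, hδ, hFδ⟩ := Metric.continuousAt_iff.1 (hF.continuousAt (x := x t)) ε hε
  have hFδ' : ∀ y, ‖y - x t‖ < δ → ‖F y - F (x t)‖ ≤ ε := fun y hy => by
    rw [← dist_eq_norm] at hy ⊢
    exact (hFδ hy).le
  -- The factor 2 serves the case s < t, where the estimate starts at s: half of δ covers the
  -- distance from x s to x t, the other half the ball around x s.
  have hnear : ∀ᶠ s in 𝓝[Ici 0] t, |s - t| * (2 * M) < δ := by
    have : Tendsto (fun s => |s - t| * (2 * M)) (𝓝 t) (𝓝 (|t - t| * (2 * M))) :=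
      Continuous.tendsto (by fun_prop) t
    exact (this.mono_left nhdsWithin_le_nhds).eventually_lt_const (by simpa using hδ)
  filter_upwards [hnear, self_mem_nhdsWithin] with s hs hs0
  rcases le_total t s with hts | hst
  · rw [Real.norm_eq_abs]
    rw [abs_of_nonneg (sub_nonneg.2 hts)] at hs ⊢
    rw [mul_comm ε]
    exact key t s _ ε δ ht hts hε.le hFδ'
      (by nlinarith [mul_nonneg (sub_nonneg.2 hts) hM0])
  · rw [Real.norm_eq_abs]
    rw [abs_of_nonpos (sub_nonpos.2 hst), neg_sub] at hs ⊢
    have hd := hLip s t hs0 hst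
    have := key s t (F (x t)) ε (δ / 2) hs0 hst hε.le (fun y hy => hFδ' y (by
      calc _ ≤ ‖y - x s‖ + ‖x s - x t‖ := norm_sub_le_norm_sub_add_norm_sub _ _ _
        _ < δ := by rw [norm_sub_rev (x s)]; linarith)) (by linarith)
    have e : x s - x t - (s - t) • F (x t) = -(x t - x s - (t - s) • F (x t)) := by module
    rw [e, norm_neg, mul_comm ε]
    exact this

/-- A continuous vector field agrees on any closed ball with a bounded one that is a nonnegative
multiple of it. -/
theorem exists_bounded_cutoff [ProperSpace E] {F : E → E} (hF : Continuous F) (r : ℝ) :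
    ∃ χ : E → ℝ, Continuous χ ∧ (∀ y, 0 ≤ χ y) ∧ (∀ y, ‖y‖ ≤ r → χ y = 1) ∧
      ∃ M, ∀ y, ‖χ y • F y‖ ≤ M := by
  refine ⟨fun y => max 0 (min 1 (r + 1 - ‖y‖)), by fun_prop, fun y => le_max_left _ _,
    fun y hy => ?_, ?_⟩
  · dsimp only
    rw [min_eq_left (by linarith), max_eq_right zero_le_one]
  · obtain ⟨M, hM⟩ := (isCompact_closedBall (0 : E) (r + 1)).exists_bound_of_continuousOn
      hF.continuousOn
    refine ⟨max 0 M, fun y => ?_⟩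
    by_cases hy : ‖y‖ ≤ r + 1
    · rw [norm_smul, Real.norm_of_nonneg (le_max_left _ _)]
      calc _ ≤ 1 * ‖F y‖ := by
            gcongr
            exact max_le zero_le_one (min_le_left _ _)
        _ ≤ _ := by
            rw [one_mul]
            exact (hM y (by simpa using hy)).trans (le_max_right _ _)
    · dsimp only
      rw [max_eq_left ((min_le_right _ _).trans (by linarith)), zero_smul, norm_zero]
      exact le_max_left _ _

end Peano

/-! ### Lyapunov theory for continuous vector fields. -/

section Lyapunov

variable {n : ℕ}

theorem hasDerivWithinAt_comp_gradient {V : State n → ℝ} (hV : ContDiff ℝ 1 V) {x : ℝ → State n}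
    {v : State n} {I : Set ℝ} {t : ℝ} (hx : HasDerivWithinAt x v I t) :
    HasDerivWithinAt (fun s => V (x s)) (inner ℝ (gradient V (x t)) v) I t := by
  have h := (((hV.differentiable one_ne_zero) (x t)).hasGradientAt).hasFDerivAt
  exact h.comp_hasDerivWithinAt t hx

theorem continuous_gradient {V : State n → ℝ} (hV : ContDiff ℝ 1 V) : Continuous (gradient V) :=
  (InnerProductSpace.toDual ℝ (State n)).symm.continuous.comp (hV.continuous_fderiv one_ne_zero)

theorem antitoneOn_of_hasDerivWithinAt_nonpos' {I : Set ℝ} (hI : Convex ℝ I) {φ φ' : ℝ → ℝ}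
    (h : ∀ t ∈ I, HasDerivWithinAt φ (φ' t) I t) (h' : ∀ t ∈ I, φ' t ≤ 0) : AntitoneOn φ I := by
  have hd : ∀ t ∈ interior I, HasDerivAt φ (φ' t) t := fun t ht =>
    (h t (interior_subset ht)).hasDerivAt (mem_interior_iff_mem_nhds.1 ht)
  exact antitoneOn_of_deriv_nonpos hI (fun t ht => (h t ht).continuousWithinAt)
    (fun t ht => (hd t ht).differentiableAt.differentiableWithinAt)
    fun t ht => (hd t ht).deriv ▸ h' t (interior_subset ht)

theorem IsSolutionOn.antitoneOn_comp {F : State n → State n} {x : ℝ → State n} {I : Set ℝ}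
    (hx : IsSolutionOn F x I) (hI : Convex ℝ I) {V : State n → ℝ} (hV : ContDiff ℝ 1 V)
    (hF : ∀ y, inner ℝ (gradient V y) (F y) ≤ 0) : AntitoneOn (fun t => V (x t)) I :=
  antitoneOn_of_hasDerivWithinAt_nonpos' hI
    (fun t ht => hasDerivWithinAt_comp_gradient hV (hx t ht)) fun t _ => hF (x t)

namespace IsClassP

variable {V : State n → ℝ}

theorem nonneg (hV : IsClassP V) (x : State n) : 0 ≤ V x := by
  by_cases h : x = 0
  · rw [h, hV.map_zero]
  · exact (hV.pos x h).le

theorem gradient_zero (hV : IsClassP V) : gradient V 0 = 0 := by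
  have h : IsLocalMin V 0 := Filter.Eventually.of_forall fun x => by
    rw [hV.map_zero]; exact hV.nonneg x
  simp [gradient, h.fderiv_eq_zero]

theorem isCompact_sublevel (hV : IsClassP V) (c : ℝ) : IsCompact {x | V x ≤ c} := by
  obtain ⟨K, hK, hKV⟩ := mem_cocompact.1 (hV.proper.eventually_gt_atTop c)
  refine hK.of_isClosed_subset (isClosed_le hV.contDiff.continuous continuous_const) fun x hx => ?_
  by_contra hxK
  have hlt : c < V x := hKV hxK
  exact hlt.not_ge hx

/-- V has a positive minimum on the part of the compact set {V ≤ 1} outside the ε-ball; c is the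
smaller of 1 and this minimum. -/
theorem exists_sublevel_subset_ball (hV : IsClassP V) {ε : ℝ} (hε : 0 < ε) :
    ∃ c, 0 < c ∧ ∀ x, V x < c → ‖x‖ < ε := by
  have hK : IsCompact ({x | V x ≤ 1} ∩ {x | ε ≤ ‖x‖}) :=
    (hV.isCompact_sublevel 1).inter_right (isClosed_le continuous_const continuous_norm)
  rcases eq_empty_or_nonempty ({x | V x ≤ 1} ∩ {x | ε ≤ ‖x‖}) with he | hne
  · refine ⟨1, one_pos, fun x hx => ?_⟩
    by_contra h
    exact (he ▸ (⟨hx.le, not_lt.1 h⟩ : x ∈ {x | V x ≤ 1} ∩ {x | ε ≤ ‖x‖}) : x ∈ (∅ : Set _))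
  · obtain ⟨y, hy, hmin⟩ := hK.exists_isMinOn hne hV.contDiff.continuous.continuousOn
    have hy0 : y ≠ 0 := norm_pos_iff.1 (hε.trans_le hy.2)
    refine ⟨min 1 (V y), lt_min one_pos (hV.pos y hy0), fun x hx => ?_⟩
    by_contra h
    exact absurd (hmin ⟨(hx.trans_le (min_le_left _ _)).le, not_lt.1 h⟩)
      (not_le.2 (hx.trans_le (min_le_right _ _)))

/-- Cutting F off by a nonnegative factor keeps V nonincreasing, so the solution of the bounded
field stays in a sublevel set where the factor is 1. -/
theorem exists_solution (hV : IsClassP V) {F : State n → State n} (hF : Continuous F)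
    (hdec : ∀ y, inner ℝ (gradient V y) (F y) ≤ 0) (x₀ : State n) :
    ∃ x : ℝ → State n, x 0 = x₀ ∧ IsSolutionOn F x (Ici 0) := by
  obtain ⟨r, hr⟩ := (hV.isCompact_sublevel (V x₀)).isBounded.exists_norm_le
  obtain ⟨χ, hχ, hχ0, hχ1, M, hM⟩ := exists_bounded_cutoff hF r
  obtain ⟨x, hx0, hx⟩ := exists_solution_of_continuous_of_bounded (hχ.smul hF) hM x₀
  refine ⟨x, hx0, fun t ht => ?_⟩
  have ha : AntitoneOn (fun t => V (x t)) (Ici 0) :=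
    IsSolutionOn.antitoneOn_comp (F := fun y => χ y • F y) hx (convex_Ici 0) hV.contDiff
      fun y => by
        rw [inner_smul_right]
        exact mul_nonpos_of_nonneg_of_nonpos (hχ0 y) (hdec y)
  have hle : V (x t) ≤ V x₀ := hx0 ▸ ha self_mem_Ici ht ht
  simpa [hχ1 _ (hr _ hle)] using hx t ht

/-- The solution stays in a compact sublevel set, so its speed is bounded and it is Lipschitz. Hence
it has a limit at T, from which a new solution is started and glued on. -/
theorem exists_continuation (hV : IsClassP V) {F : State n → State n} (hF : Continuous F)
    (hdec : ∀ y, inner ℝ (gradient V y) (F y) ≤ 0) {T : ℝ} (hT : 0 < T) {x : ℝ → State n}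
    (hx : IsSolutionOn F x (Ico 0 T)) :
    ∃ y : ℝ → State n, EqOn y x (Ico 0 T) ∧ IsSolutionOn F y (Ici 0) := by
  obtain ⟨M, hM⟩ := (hV.isCompact_sublevel (V (x 0))).exists_bound_of_continuousOn hF.continuousOn
  have hle : ∀ t ∈ Ico 0 T, ‖F (x t)‖ ≤ M := fun t ht =>
    hM _ (hx.antitoneOn_comp (convex_Ico 0 T) hV.contDiff hdec ⟨le_rfl, hT⟩ ht ht.1)
  have hLip : LipschitzOnWith M.toNNReal x (Ico 0 T) :=
    (convex_Ico 0 T).lipschitzOnWith_of_nnnorm_hasDerivWithin_le hx fun t ht => by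
      rw [← NNReal.coe_le_coe, coe_nnnorm]
      exact (hle t ht).trans (Real.le_coe_toNNReal M)
  obtain ⟨X, hXL, hXx⟩ := hLip.extend_finite_dimension
  obtain ⟨z, hz0, hz⟩ := hV.exists_solution hF hdec (X T)
  let y : ℝ → State n := fun t => if t < T then x t else z (t - T)
  have hyx : ∀ t, t < T → y t = x t := fun t ht => if_pos ht
  have hyz : ∀ t, T ≤ t → y t = z (t - T) := fun t ht => if_neg (not_lt.2 ht)
  have hright : ∀ t ∈ Ici T, HasDerivWithinAt y (F (y t)) (Ici T) t := by
    intro t ht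
    have h1 := (hz (t - T) (mem_Ici.2 (sub_nonneg.2 ht))).scomp t
      (((hasDerivAt_id t).sub_const T).hasDerivWithinAt (s := Ici T))
      fun s hs => sub_nonneg.2 hs
    rw [one_smul] at h1
    rw [hyz t ht]
    exact h1.congr (fun s hs => hyz s hs) (hyz t ht)
  have hleft : ∀ t ∈ Ico 0 T, HasDerivWithinAt y (F (y t)) (Ico 0 T) t := fun t ht => by
    rw [hyx t ht.2]
    exact (hx t ht).congr (fun s hs => hyx s hs.2) (hyx t ht.2)
  have hIoo : Ioo 0 T ∈ 𝓝[<] T := Ioo_mem_nhdsLT hT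
  have hyT : y T = X T := by rw [hyz T le_rfl, sub_self, hz0]
  have hylim : Tendsto y (𝓝[<] T) (𝓝 (y T)) := by
    rw [hyT]
    refine ((hXL.continuous.tendsto T).mono_left nhdsWithin_le_nhds).congr' ?_
    filter_upwards [hIoo] with s hs
    rw [hyx s hs.2, hXx (Ioo_subset_Ico_self hs)]
  have hderiv : ∀ t ∈ Ioo 0 T, HasDerivAt y (F (y t)) t := fun t ht =>
    (hleft t (Ioo_subset_Ico_self ht)).hasDerivAt (Ico_mem_nhds ht.1 ht.2)
  -- At the gluing time the left derivative is the limit of the derivatives F (y s), by continuity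
  -- of F.
  have hTleft : HasDerivWithinAt y (F (y T)) (Iic T) T := by
    refine hasDerivWithinAt_Iic_of_tendsto_deriv (s := Ioo 0 T)
      (fun t ht => (hderiv t ht).differentiableAt.differentiableWithinAt)
      (hylim.mono_left (nhdsWithin_mono _ fun s hs => hs.2)) hIoo ?_
    refine ((hF.tendsto (y T)).comp hylim).congr' ?_
    filter_upwards [hIoo] with s hs
    exact (hderiv s hs).deriv.symm
  refine ⟨y, fun t ht => hyx t ht.2, fun t ht => ?_⟩
  rcases lt_trichotomy t T with h | rfl | h
  · refine (hleft t ⟨ht, h⟩).mono_of_mem_nhdsWithin ?_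
    rw [← Ici_inter_Iio]
    exact inter_mem_nhdsWithin _ (Iio_mem_nhds h)
  · refine (hTleft.union (hright t self_mem_Ici)).mono fun s _ => ?_
    exact le_total s t
  · exact ((hright t h.le).hasDerivAt (Ici_mem_nhds h)).hasDerivWithinAt

/-- **Lyapunov's theorem** on global asymptotic stability, for continuous vector fields. -/
theorem isGloballyAsymptoticallyStable (hV : IsClassP V) {F : State n → State n}
    (hF : Continuous F) (hF0 : F 0 = 0) {w : State n → ℝ} (hw : Continuous w) (hw0 : w 0 = 0)
    (hwpos : ∀ y, y ≠ 0 → 0 < w y) (hdec : ∀ y, inner ℝ (gradient V y) (F y) ≤ -w y) :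
    IsGloballyAsymptoticallyStable F := by
  have hdec' : ∀ y, inner ℝ (gradient V y) (F y) ≤ 0 := fun y => (hdec y).trans <| by
    by_cases hy : y = 0
    · simp [hy, hw0]
    · exact neg_nonpos.2 (hwpos y hy).le
  have hanti : ∀ x, IsSolutionOn F x (Ici 0) → AntitoneOn (fun t => V (x t)) (Ici 0) :=
    fun x hx => hx.antitoneOn_comp (convex_Ici 0) hV.contDiff hdec'
  refine ⟨hF0, hV.exists_solution hF hdec', fun T hT x hx => hV.exists_continuation hF hdec' hT hx,
    fun ε hε => ?_, fun x hx => ?_⟩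
  · obtain ⟨c, hc, hcV⟩ := hV.exists_sublevel_subset_ball hε
    obtain ⟨δ, hδ, hδV⟩ := Metric.continuousAt_iff.1
      (hV.contDiff.continuous.continuousAt (x := (0 : State n))) c hc
    refine ⟨δ, hδ, fun x hx hx0 t ht => hcV _ ?_⟩
    have h1 := hδV (x := x 0) (by simpa using hx0)
    rw [hV.map_zero, Real.dist_eq, sub_zero] at h1
    exact (hanti x hx self_mem_Ici ht ht).trans_lt ((le_abs_self _).trans_lt h1)
  · rw [Metric.tendsto_atTop]
    intro ε hε
    obtain ⟨c, hc, hcV⟩ := hV.exists_sublevel_subset_ball hε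
    obtain ⟨T, hT, hVT⟩ : ∃ T ∈ Ici (0 : ℝ), V (x T) < c := by
      -- Otherwise the trajectory stays in a compact shell on which w has a positive minimum w y; V
      -- then falls at least at that rate and is nonpositive by time V (x 0) / w y.
      by_contra! hge
      have hK : IsCompact ({y | V y ≤ V (x 0)} ∩ {y | c ≤ V y}) :=
        (hV.isCompact_sublevel _).inter_right
          (isClosed_le continuous_const hV.contDiff.continuous)
      obtain ⟨y, hy, hmin⟩ := hK.exists_isMinOn ⟨x 0, le_refl (V (x 0)), hge 0 self_mem_Ici⟩
        hw.continuousOn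
      have hy0 : y ≠ 0 := by
        rintro rfl
        exact absurd hy.2 (not_le.2 (hV.map_zero.symm ▸ hc))
      have hwy := hwpos y hy0
      have ha : AntitoneOn (fun t => V (x t) + t * w y) (Ici 0) :=
        antitoneOn_of_hasDerivWithinAt_nonpos' (convex_Ici 0)
          (fun t ht => (hasDerivWithinAt_comp_gradient hV.contDiff (hx t ht)).add
            ((hasDerivWithinAt_id t _).mul_const (w y))) fun t ht => by
          have h1 : w y ≤ w (x t) := hmin ⟨hanti x hx self_mem_Ici ht ht, hge t ht⟩
          linarith [hdec (x t)]
      have ht : V (x 0) / w y ∈ Ici (0 : ℝ) := div_nonneg (hV.nonneg _) hwy.le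
      have h2 := ha self_mem_Ici ht ht
      simp only [zero_mul, add_zero, div_mul_cancel₀ _ hwy.ne'] at h2
      linarith [hge _ ht]
    refine ⟨T, fun t ht => ?_⟩
    rw [dist_zero_right]
    exact hcV _ ((hanti x hx hT (hT.trans ht : (0 : ℝ) ≤ t) ht).trans_lt hVT)

end IsClassP

/-- Comparison along the trajectories of an asymptotically stable system. -/
theorem IsGloballyAsymptoticallyStable.le_of_inner_gradient_le {F : State n → State n}
    (hF : IsGloballyAsymptoticallyStable F) {A B : State n → ℝ} (hA : ContDiff ℝ 1 A)
    (hB : ContDiff ℝ 1 B) (h0 : A 0 = B 0)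
    (hAB : ∀ y, inner ℝ (gradient A y) (F y) ≤ inner ℝ (gradient B y) (F y)) (x₀ : State n) :
    B x₀ ≤ A x₀ := by
  obtain ⟨x, rfl, hx⟩ := hF.exists_solution x₀
  have ha : AntitoneOn (fun t => A (x t) - B (x t)) (Ici 0) :=
    antitoneOn_of_hasDerivWithinAt_nonpos' (convex_Ici 0)
      (fun t ht => (hasDerivWithinAt_comp_gradient hA (hx t ht)).sub
        (hasDerivWithinAt_comp_gradient hB (hx t ht))) fun t _ => sub_nonpos.2 (hAB (x t))
  have hlim : Tendsto (fun t => A (x t) - B (x t)) atTop (𝓝 (A 0 - B 0)) :=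
    ((hA.continuous.sub hB.continuous).tendsto 0).comp (hF.attractive x hx)
  rw [h0, sub_self] at hlim
  refine sub_nonneg.1 (le_of_tendsto hlim ?_)
  filter_upwards [eventually_ge_atTop 0] with t ht
  exact ha self_mem_Ici ht ht

end Lyapunov

/-! ### Completing the square, stabilization and comparison. -/

namespace PolyControlProblem

variable {n m : ℕ} (S : PolyControlProblem n m)

/-- The control cost `vᵀ R(x) v`. -/
noncomputable def controlCost (x : State n) (v : Control m) : ℝ := v ⬝ᵥ (S.RAt x *ᵥ v)

theorem continuous_fAt : Continuous S.fAt :=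
  (PiLp.continuous_toLp 2 _).comp <| continuous_pi fun j =>
    (MvPolynomial.continuous_eval (S.f j)).comp (PiLp.continuous_ofLp 2 _)

theorem continuous_gAt : Continuous S.gAt :=
  continuous_matrix fun i j =>
    (MvPolynomial.continuous_eval (S.g i j)).comp (PiLp.continuous_ofLp 2 _)

theorem continuous_qAt : Continuous S.qAt :=
  (MvPolynomial.continuous_eval S.q).comp (PiLp.continuous_ofLp 2 _)

theorem continuous_RAt : Continuous S.RAt :=
  continuous_matrix fun i j =>
    (MvPolynomial.continuous_eval (S.R i j)).comp (PiLp.continuous_ofLp 2 _)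

theorem RAt_posDef (x : State n) : (S.RAt x).PosDef := S.R_posDef x.ofLp

theorem isUnit_det_RAt (x : State n) : IsUnit (S.RAt x).det := (S.RAt_posDef x).det_pos.ne'.isUnit

theorem continuous_RAt_inv : Continuous fun x => (S.RAt x)⁻¹ := by
  simp only [Matrix.inv_def, Ring.inverse_eq_inv']
  exact (S.continuous_RAt.matrix_det.inv₀ fun x => (S.RAt_posDef x).det_pos.ne').smul
    S.continuous_RAt.matrix_adjugate

theorem continuous_dynamics {X : Type*} [TopologicalSpace X] {ξ : X → State n} {v : X → Control m}
    (hξ : Continuous ξ) (hv : Continuous v) : Continuous fun p => S.dynamics (ξ p) (v p) :=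
  (S.continuous_fAt.comp hξ).add <| (PiLp.continuous_toLp 2 _).comp <|
    (S.continuous_gAt.comp hξ).matrix_mulVec hv

theorem continuous_controlCost :
    Continuous fun p : State n × Control m => S.controlCost p.1 p.2 :=
  continuous_snd.dotProduct ((S.continuous_RAt.comp continuous_fst).matrix_mulVec continuous_snd)

theorem continuous_improvedPolicy {V : State n → ℝ} (hV : ContDiff ℝ 1 V) :
    Continuous (S.improvedPolicy V) := by
  unfold improvedPolicy
  exact ((S.continuous_RAt_inv.matrix_mulVec (S.continuous_gAt.matrix_transpose.matrix_mulVec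
    ((PiLp.continuous_ofLp 2 _).comp (continuous_gradient hV)))).const_smul (1 / 2 : ℝ)).neg

theorem continuous_opH {V : State n → ℝ} (hV : ContDiff ℝ 1 V) : Continuous (S.opH V) := by
  have hg := continuous_gradient hV
  have hg' : Continuous fun x => (gradient V x).ofLp := (PiLp.continuous_ofLp 2 _).comp hg
  exact ((hg.inner S.continuous_fAt).add S.continuous_qAt).sub <| continuous_const.mul <|
    hg'.dotProduct <| S.continuous_gAt.matrix_mulVec <| S.continuous_RAt_inv.matrix_mulVec <|
      S.continuous_gAt.matrix_transpose.matrix_mulVec hg'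

theorem controlCost_nonneg (x : State n) (v : Control m) : 0 ≤ S.controlCost x v := by
  simpa [controlCost] using (S.RAt_posDef x).posSemidef.dotProduct_mulVec_nonneg v

theorem eq_zero_of_controlCost_nonpos {x : State n} {v : Control m} (h : S.controlCost x v ≤ 0) :
    v = 0 := by
  by_contra hv
  have := (S.RAt_posDef x).dotProduct_mulVec_pos hv
  exact absurd h (not_le.2 (by simpa [controlCost] using this))

theorem controlCost_sub_comm (x : State n) (v w : Control m) :
    S.controlCost x (v - w) = S.controlCost x (w - v) := by
  rw [← neg_sub w v, controlCost, Matrix.mulVec_neg, neg_dotProduct_neg, controlCost]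

theorem dotProduct_RAt_mulVec_comm (x : State n) (v w : Control m) :
    v ⬝ᵥ (S.RAt x *ᵥ w) = w ⬝ᵥ (S.RAt x *ᵥ v) := by
  have h : (S.RAt x)ᵀ = S.RAt x := by
    simpa [Matrix.IsHermitian, Matrix.conjTranspose_eq_transpose_of_trivial]
      using (S.RAt_posDef x).isHermitian
  rw [Matrix.dotProduct_mulVec, ← Matrix.mulVec_transpose, h, dotProduct_comm]

/-- Solving the policy formula for gᵀ∇V removes R⁻¹ from the later computations and expresses them
through `controlCost`. -/
theorem transpose_gAt_mulVec_gradient (V : State n → ℝ) (x : State n) :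
    (S.gAt x)ᵀ *ᵥ (gradient V x).ofLp = (-2 : ℝ) • (S.RAt x *ᵥ S.improvedPolicy V x) := by
  rw [improvedPolicy, Matrix.mulVec_neg, Matrix.mulVec_smul, Matrix.mulVec_mulVec,
    Matrix.mul_nonsing_inv _ (S.isUnit_det_RAt x), Matrix.one_mulVec, smul_neg, smul_smul]
  norm_num

theorem inner_toLp_gAt (V : State n → ℝ) (x : State n) (v : Control m) :
    inner ℝ (gradient V x) (WithLp.toLp 2 (S.gAt x *ᵥ v) : State n)
      = -2 * (v ⬝ᵥ (S.RAt x *ᵥ S.improvedPolicy V x)) := by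
  rw [EuclideanSpace.inner_eq_star_dotProduct, star_trivial, dotProduct_comm,
    Matrix.dotProduct_mulVec, ← Matrix.mulVec_transpose, transpose_gAt_mulVec_gradient,
    smul_dotProduct, dotProduct_comm, smul_eq_mul]

theorem opH_eq (V : State n → ℝ) (x : State n) :
    S.opH V x = inner ℝ (gradient V x) (S.fAt x) + S.qAt x
      - S.controlCost x (S.improvedPolicy V x) := by
  have h1 : (S.RAt x)⁻¹ *ᵥ ((S.gAt x)ᵀ *ᵥ (gradient V x).ofLp)
      = (-2 : ℝ) • S.improvedPolicy V x := by
    rw [improvedPolicy, smul_neg, smul_smul]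
    norm_num
  rw [opH, h1, Matrix.dotProduct_mulVec, ← Matrix.mulVec_transpose, transpose_gAt_mulVec_gradient,
    smul_dotProduct, dotProduct_smul, dotProduct_comm, controlCost, smul_eq_mul, smul_eq_mul]
  ring

/-- Completing the square in the control. -/
theorem opL_eq (V : State n → ℝ) (u : State n → Control m) (x : State n) :
    S.opL V u x = -S.opH V x - S.controlCost x (u x - S.improvedPolicy V x) := by
  rw [opL, opH_eq, dynamics, inner_add_right, inner_toLp_gAt, runningCost]
  simp only [controlCost, Matrix.mulVec_sub, sub_dotProduct, dotProduct_sub]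
  rw [S.dotProduct_RAt_mulVec_comm x (S.improvedPolicy V x) (u x)]
  ring

theorem inner_gradient_dynamics (V : State n → ℝ) (u : State n → Control m) (x : State n) :
    inner ℝ (gradient V x) (S.dynamics x (u x))
      = -S.opL V u x - S.qAt x - S.controlCost x (u x) := by
  rw [opL, runningCost, controlCost]
  ring

theorem inner_gradient_dynamics_le_iff {V W : State n → ℝ} {u : State n → Control m}
    {x : State n} :
    inner ℝ (gradient V x) (S.dynamics x (u x)) ≤ inner ℝ (gradient W x) (S.dynamics x (u x)) ↔
      S.opL W u x ≤ S.opL V u x := by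
  rw [inner_gradient_dynamics, inner_gradient_dynamics]
  constructor <;> intro h <;> linarith

variable {S}

/-- The derivative of V along the closed loop is at most -q. -/
theorem globallyStabilizing_of_opL_nonneg {V : State n → ℝ} (hV : IsClassP V)
    {u : State n → Control m} (hu : Continuous u) (h : ∀ x, 0 ≤ S.opL V u x) :
    S.GloballyStabilizing u := by
  have hq0 : S.qAt 0 = 0 := S.q_zero
  -- At the origin ∇V and q vanish, so the hypothesis on ℒ says that the control cost is
  -- nonpositive.
  have hu0 : u 0 = 0 := by
    refine S.eq_zero_of_controlCost_nonpos (x := 0) ?_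
    have h0 := S.inner_gradient_dynamics V u 0
    rw [hV.gradient_zero, inner_zero_left, hq0] at h0
    linarith [h 0]
  have hf0 : S.fAt 0 = 0 := by
    ext j
    exact S.f_zero j
  refine hV.isGloballyAsymptoticallyStable (S.continuous_dynamics continuous_id hu)
    (by simp [dynamics, hf0, hu0]) S.continuous_qAt hq0
    (fun y hy => S.q_pos y.ofLp fun h0 => hy (by ext j; exact congrFun h0 j)) fun y => ?_
  have := S.inner_gradient_dynamics V u y
  change inner ℝ (gradient V y) (S.dynamics y (u y)) ≤ _
  linarith [h y, S.controlCost_nonneg y (u y)]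

theorem le_of_opL_le {u : State n → Control m} (hu : S.GloballyStabilizing u) {V W : State n → ℝ}
    (hV : ContDiff ℝ 1 V) (hW : ContDiff ℝ 1 W) (h0 : V 0 = W 0)
    (h : ∀ x, S.opL W u x ≤ S.opL V u x) (x : State n) : W x ≤ V x :=
  IsGloballyAsymptoticallyStable.le_of_inner_gradient_le hu hV hW h0
    (fun y => S.inner_gradient_dynamics_le_iff.2 (h y)) x

theorem opL_improvedPolicy (V : State n → ℝ) (x : State n) :
    S.opL V (S.improvedPolicy V) x = -S.opH V x := by
  rw [opL_eq, sub_self, controlCost, zero_dotProduct, sub_zero]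

theorem opL_nonpos_of_opH_eq_zero {V : State n → ℝ} (h : ∀ x, S.opH V x = 0)
    (u : State n → Control m) (x : State n) : S.opL V u x ≤ 0 := by
  rw [opL_eq, h]
  linarith [S.controlCost_nonneg x (u x - S.improvedPolicy V x)]

/-- By completing the square, ℒ(V,u) = 0 forces -ℋ(V) to be a control cost. -/
theorem opL_improvedPolicy_nonneg {V : State n → ℝ} {u : State n → Control m} {x : State n}
    (h : S.opL V u x = 0) : 0 ≤ S.opL V (S.improvedPolicy V) x := by
  rw [opL_improvedPolicy]
  rw [opL_eq] at h
  linarith [S.controlCost_nonneg x (u x - S.improvedPolicy V x)]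

/-- The solution in `𝒫` of the Hamilton-Jacobi-Bellman equation is its largest `C¹` solution that
vanishes at the origin. -/
theorem le_of_opH_eq_zero {Vo V : State n → ℝ} (hVo : IsClassP Vo) (hHJB : ∀ x, S.opH Vo x = 0)
    (hV : ContDiff ℝ 1 V) (hV0 : V 0 = 0) (hH : ∀ x, S.opH V x = 0) (x : State n) :
    V x ≤ Vo x := by
  have ho : ∀ x, S.opL Vo (S.improvedPolicy Vo) x = 0 := fun x => by
    rw [opL_improvedPolicy, hHJB, neg_zero]
  refine le_of_opL_le (globallyStabilizing_of_opL_nonneg hVo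
    (S.continuous_improvedPolicy hVo.contDiff) fun x => (ho x).ge) hVo.contDiff hV
    (by rw [hVo.map_zero, hV0]) (fun y => ?_) x
  rw [ho]
  exact opL_nonpos_of_opH_eq_zero hH _ y

end PolyControlProblem

/-! ### From pointwise to locally uniform convergence, and derivatives of limits. -/

/-- A pointwise limit of a sequence of continuous functions on a Baire space is a locally uniform
limit at the points of a dense set. -/
theorem dense_setOf_tendsto_prod_nhds {X Y : Type*} [TopologicalSpace X] [BaireSpace X]
    [PseudoMetricSpace Y] {u : ℕ → X → Y} {v : X → Y} (hu : ∀ i, Continuous (u i))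
    (h : ∀ x, Tendsto (fun i => u i x) atTop (𝓝 (v x))) :
    Dense {x | Tendsto (fun p : ℕ × X => u p.1 p.2) (atTop ×ˢ 𝓝 x) (𝓝 (v x))} := by
  let C : ℕ → ℕ → Set X := fun k N =>
    {y | ∀ i ≥ N, ∀ j ≥ N, dist (u i y) (u j y) ≤ 1 / (k + 1)}
  have hC : ∀ k N, IsClosed (C k N) := fun k N => by
    simp only [C, ofPred_forall]
    exact isClosed_iInter fun i => isClosed_iInter fun _ => isClosed_iInter fun j =>
      isClosed_iInter fun _ => isClosed_le ((hu i).dist (hu j)) continuous_const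
  have hcover : ∀ k, ⋃ N, C k N = univ := fun k => by
    refine eq_univ_of_forall fun x => mem_iUnion.2 ?_
    obtain ⟨N, hN⟩ := Metric.cauchySeq_iff.1 (h x).cauchySeq (1 / ((k : ℝ) + 1)) (by positivity)
    exact ⟨N, fun i hi j hj => (hN i hi j hj).le⟩
  -- For each k the closed sets C k N cover the space, so by Baire their interiors have dense union,
  -- and so does the intersection over k.
  refine (dense_iInter_of_isOpen_nat (f := fun k => ⋃ N, interior (C k N))
    (fun k => isOpen_iUnion fun N => isOpen_interior)
    fun k => dense_iUnion_interior_of_closed (hC k) (hcover k)).mono fun x hx => ?_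
  rw [mem_ofPred_eq, Metric.tendsto_nhds]
  intro ε hε
  obtain ⟨k, hk⟩ := exists_nat_one_div_lt (show 0 < ε / 4 by positivity)
  obtain ⟨N, hN⟩ := mem_iUnion.1 (mem_iInter.1 hx k)
  have hlim : dist (u N x) (v x) ≤ 1 / (k + 1) := by
    refine le_of_tendsto (tendsto_const_nhds.dist (h x)) ?_
    filter_upwards [eventually_ge_atTop N] with j hj
    exact interior_subset hN N le_rfl j hj
  have hcont : ∀ᶠ y in 𝓝 x, dist (u N y) (u N x) < ε / 4 :=
    Metric.tendsto_nhds.1 ((hu N).tendsto x) _ (by positivity)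
  filter_upwards [(eventually_ge_atTop N).prod_mk (hcont.and (mem_interior_iff_mem_nhds.1 hN))]
    with p hp
  have h1 := hp.2.2 p.1 hp.1 N le_rfl
  have h2 := dist_triangle4 (u p.1 p.2) (u N p.2) (u N x) (v x)
  linarith [hp.2.1]

/-- The derivative of a pointwise limit along a continuous vector field, at a point where the
derivatives along that field converge locally uniformly. -/
theorem inner_gradient_eq_of_tendsto {n : ℕ} {V : ℕ → State n → ℝ} {W : State n → ℝ}
    (hV : ∀ i, ContDiff ℝ 1 (V i)) (hW : ContDiff ℝ 1 W)
    (hVW : ∀ x, Tendsto (fun i => V i x) atTop (𝓝 (W x))) {F : State n → State n}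
    (hF : Continuous F) {x : State n} {c : ℝ}
    (h : Tendsto (fun p : ℕ × State n => inner ℝ (gradient (V p.1) p.2) (F p.2))
      (atTop ×ˢ 𝓝 x) (𝓝 c)) :
    inner ℝ (gradient W x) (F x) = c := by
  -- F may have no global solution; the truncated field agrees with F near x, which suffices for a
  -- derivative at time 0.
  obtain ⟨χ, hχ, -, hχ1, M, hM⟩ := exists_bounded_cutoff hF (‖x‖ + 1)
  obtain ⟨z, rfl, hz⟩ := exists_solution_of_continuous_of_bounded (hχ.smul hF) hM x
  have hz0 : Tendsto z (𝓝[Ici 0] 0) (𝓝 (z 0)) := (hz 0 self_mem_Ici).continuousWithinAt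
  have hnorm : ∀ᶠ y in 𝓝 (z 0), ‖y‖ < ‖z 0‖ + 1 :=
    continuous_norm.continuousAt.eventually_lt_const (by linarith)
  have hd : HasDerivWithinAt (fun t => W (z t)) c (Ici 0) 0 := by
    rw [hasDerivWithinAt_iff_isLittleO, Asymptotics.isLittleO_iff]
    intro ε hε
    obtain ⟨P, hP, Q, hQ, hPQ⟩ := Filter.eventually_prod_iff.1
      (Metric.tendsto_nhds.1 h ε hε)
    obtain ⟨N, hN⟩ := eventually_atTop.1 hP
    obtain ⟨τ, hτ, hτQ⟩ := mem_nhdsGE_iff_exists_Ico_subset.1 (hz0.eventually (hQ.and hnorm))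
    filter_upwards [Ico_mem_nhdsGE hτ] with t ht
    -- The mean value inequality gives a bound uniform in i, so pointwise convergence of V i is
    -- enough to pass to the limit.
    have hbound : ∀ i ≥ N, ‖V i (z t) - V i (z 0) - t * c‖ ≤ ε * t := by
      intro i hi
      have key := norm_image_sub_le_of_norm_deriv_le_segment' (a := 0) (b := t) (C := ε)
        (f := fun s => V i (z s) - s * c)
        (f' := fun s => inner ℝ (gradient (V i) (z s)) (χ (z s) • F (z s)) - 1 * c)
        (fun s hs => ((hasDerivWithinAt_comp_gradient (hV i) (hz s hs.1)).mono
          (fun r hr => hr.1)).sub ((hasDerivWithinAt_id s _).mul_const c))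
        (fun s hs => by
          have hs' := hτQ ⟨hs.1, hs.2.trans ht.2⟩
          have hb := hPQ (hN i hi) hs'.1
          rw [hχ1 _ hs'.2.le, one_smul, one_mul, ← dist_eq_norm]
          exact hb.le) t ⟨ht.1, le_rfl⟩
      have e : V i (z t) - V i (z 0) - t * c = V i (z t) - t * c - (V i (z 0) - 0 * c) := by ring
      rw [e]
      simpa using key
    rw [sub_zero, Real.norm_of_nonneg (r := t) ht.1, smul_eq_mul]
    refine le_of_tendsto ((((hVW (z t)).sub (hVW (z 0))).sub_const (t * c)).norm) ?_
    filter_upwards [eventually_ge_atTop N] with i hi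
    exact hbound i hi
  have hd' := hasDerivWithinAt_comp_gradient hW (hz 0 self_mem_Ici)
  have hu := (uniqueDiffOn_Ici (0 : ℝ) 0 self_mem_Ici).eq_deriv _ hd' hd
  rwa [Pi.smul_apply', hχ1 _ (by linarith), one_smul] at hu

/-! ### The limit equation and the induction of policy iteration. -/

namespace PolyControlProblem

variable {n m : ℕ} {S : PolyControlProblem n m}

/-- At a point where the policies converge locally uniformly, the limits of policy iteration satisfy
the Hamilton-Jacobi-Bellman equation and the policy improvement formula. -/
theorem opH_eq_zero_of_tendsto {V : ℕ → State n → ℝ} {u : ℕ → State n → Control m}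
    {W : State n → ℝ} {v : Control m} (hV : ∀ i, ContDiff ℝ 1 (V i)) (hW : ContDiff ℝ 1 W)
    (heval : ∀ i x, S.opL (V i) (u i) x = 0) (himp : ∀ i, u (i + 1) = S.improvedPolicy (V i))
    (hVW : ∀ x, Tendsto (fun i => V i x) atTop (𝓝 (W x))) {x : State n}
    (hu : Tendsto (fun p : ℕ × State n => u p.1 p.2) (atTop ×ˢ 𝓝 x) (𝓝 v)) :
    S.opH W x = 0 ∧ v = S.improvedPolicy W x := by
  have hu' : Tendsto (fun p : ℕ × State n => u (p.1 + 1) p.2) (atTop ×ˢ 𝓝 x) (𝓝 v) :=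
    hu.comp (((tendsto_add_atTop_nat 1).comp tendsto_fst).prodMk tendsto_snd)
  have hx : Tendsto (fun p : ℕ × State n => p.2) (atTop ×ˢ 𝓝 x) (𝓝 x) := tendsto_snd
  have hcost : ∀ {a : ℕ × State n → Control m} {b : Control m},
      Tendsto a (atTop ×ˢ 𝓝 x) (𝓝 b) →
      Tendsto (fun p => S.controlCost p.2 (a p)) (atTop ×ˢ 𝓝 x) (𝓝 (S.controlCost x b)) :=
    fun ha => (S.continuous_controlCost.tendsto (x, _)).comp (hx.prodMk_nhds ha)
  have hzero : S.controlCost x 0 = 0 := by rw [controlCost, zero_dotProduct]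
  -- With w frozen, the field f + gw is independent of i. Since ℋ(V_i) = -|u_i - u_{i+1}|²,
  -- completing the square writes the derivative of V_i along it through u_i and u_{i+1}, both of
  -- which tend to v.
  have key : ∀ w : Control m, S.opL W (fun _ => w) x = -S.controlCost x (w - v) := by
    intro w
    have h := inner_gradient_eq_of_tendsto hV hW hVW
      (S.continuous_dynamics continuous_id (continuous_const (y := w))) (x := x)
      (c := -S.controlCost x (v - v) + S.controlCost x (w - v) - S.qAt x - S.controlCost x w) (by
        have hlim := ((((hcost (hu.sub hu')).neg.add (hcost (hu'.const_sub w))).sub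
          ((S.continuous_qAt.tendsto x).comp hx)).sub (hcost (tendsto_const_nhds (x := w))))
        refine hlim.congr fun p => ?_
        have h1 := heval p.1 p.2
        rw [opL_eq] at h1
        have h2 := S.inner_gradient_dynamics (V p.1) (fun _ => w) p.2
        rw [opL_eq] at h2
        simp only [Function.comp, id]
        rw [h2, himp]
        linarith)
    simp only [id] at h
    rw [S.inner_gradient_dynamics W (fun _ => w) x, sub_self, hzero] at h
    linarith
  -- Write u_W for the improved policy of W. Taking w = v gives ℋ(W) = -|v - u_W|², and w = u_W
  -- gives ℋ(W) = |v - u_W|²; both vanish.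
  have h1 := key v
  have h2 := key (S.improvedPolicy W x)
  rw [opL_eq] at h1 h2
  rw [sub_self, hzero] at h1 h2
  rw [controlCost_sub_comm] at h2
  have h3 := S.controlCost_nonneg x (v - S.improvedPolicy W x)
  have h4 : S.controlCost x (v - S.improvedPolicy W x) = 0 := by linarith
  exact ⟨by linarith, sub_eq_zero.1 (S.eq_zero_of_controlCost_nonpos h4.le)⟩

/-- The iterates are assumed only C¹ and zero at the origin; positivity and properness come from the
lower bound Vᵒ. -/
theorem isClassP_of_le {n : ℕ} {V W : State n → ℝ} (hV : IsClassP V) (hW : ContDiff ℝ 1 W)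
    (hW0 : W 0 = 0) (h : ∀ x, V x ≤ W x) : IsClassP W :=
  ⟨hW, hW0, fun x hx => (hV.pos x hx).trans_le (h x), tendsto_atTop_mono h hV.proper⟩

/-- The invariant of policy iteration. -/
theorem isClassP_and_opL_nonneg {V : ℕ → State n → ℝ} {u : ℕ → State n → Control m}
    {Vo : State n → ℝ} (hV0 : IsClassP (V 0)) (hu1 : Continuous (u 1))
    (hinit : ∀ x, 0 ≤ S.opL (V 0) (u 1) x) (hVo : IsClassP Vo) (hHJB : ∀ x, S.opH Vo x = 0)
    (hC1 : ∀ i, 1 ≤ i → ContDiff ℝ 1 (V i)) (hVzero : ∀ i, 1 ≤ i → V i 0 = 0)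
    (heval : ∀ i, 1 ≤ i → ∀ x, S.opL (V i) (u i) x = 0)
    (himp : ∀ i, 1 ≤ i → u (i + 1) = S.improvedPolicy (V i)) (i : ℕ) :
    IsClassP (V i) ∧ Continuous (u (i + 1)) ∧ ∀ x, 0 ≤ S.opL (V i) (u (i + 1)) x := by
  induction i with
  | zero => exact ⟨hV0, hu1, hinit⟩
  | succ i ih =>
    obtain ⟨hP, hc, hL⟩ := ih
    have hi : 1 ≤ i + 1 := Nat.le_add_left 1 i
    refine ⟨isClassP_of_le hVo (hC1 _ hi) (hVzero _ hi) ?_, ?_, fun x => ?_⟩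
    · refine le_of_opL_le (globallyStabilizing_of_opL_nonneg hP hc hL) (hC1 _ hi) hVo.contDiff
        (by rw [hVzero _ hi, hVo.map_zero]) fun x => ?_
      rw [heval _ hi]
      exact opL_nonpos_of_opH_eq_zero hHJB _ x
    · rw [himp _ hi]
      exact S.continuous_improvedPolicy (hC1 _ hi)
    · rw [himp _ hi]
      exact opL_improvedPolicy_nonneg (heval _ hi x)

end PolyControlProblem

/-! ### The main theorem. -/

open PolyControlProblem in
theorem mainTheorem4 {n m : ℕ} (S : PolyControlProblem n m)
    (V : ℕ → State n → ℝ) (u : ℕ → State n → Control m) (Vo : State n → ℝ)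
    -- the initial pair `(V 0, u 1)`; the entry `u 0` plays no role
    (hV0 : IsClassP (V 0)) (hu1 : Continuous (u 1))
    (hinit : ∀ x, 0 ≤ S.opL (V 0) (u 1) x)
    -- the Hamilton-Jacobi-Bellman equation
    (hVo : IsClassP Vo) (hHJB : ∀ x, S.opH Vo x = 0)
    -- policy evaluation and policy improvement, for `i = 1, 2, …`
    (hC1 : ∀ i, 1 ≤ i → ContDiff ℝ 1 (V i)) (hVzero : ∀ i, 1 ≤ i → V i 0 = 0)
    (heval : ∀ i, 1 ≤ i → ∀ x, S.opL (V i) (u i) x = 0)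
    (himp : ∀ i, 1 ≤ i → u (i + 1) = S.improvedPolicy (V i)) :
    (∀ i x, Vo x ≤ V (i + 1) x ∧ V (i + 1) x ≤ V i x) ∧
    (∀ i, S.GloballyStabilizing (u (i + 1))) ∧
    (∀ (Vs : State n → ℝ) (us : State n → Control m), ContDiff ℝ 1 Vs →
      (∀ x, Tendsto (fun i => V i x) atTop (𝓝 (Vs x))) →
      (∀ x, Tendsto (fun i => u i x) atTop (𝓝 (us x))) →
      Vs = Vo ∧ ∀ x, ContinuousAt us x → us x = S.improvedPolicy Vo x) := by

  have hinv := isClassP_and_opL_nonneg hV0 hu1 hinit hVo hHJB hC1 hVzero heval himp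
  have hgs : ∀ i, S.GloballyStabilizing (u (i + 1)) := fun i =>
    globallyStabilizing_of_opL_nonneg (hinv i).1 (hinv i).2.1 (hinv i).2.2
  have hi : ∀ i, 1 ≤ i + 1 := fun i => Nat.le_add_left 1 i
  have hlower : ∀ i x, Vo x ≤ V (i + 1) x := fun i => by
    refine le_of_opL_le (hgs i) (hC1 _ (hi i)) hVo.contDiff
      (by rw [hVzero _ (hi i), hVo.map_zero]) fun x => ?_
    rw [heval _ (hi i)]
    exact opL_nonpos_of_opH_eq_zero hHJB _ x
  have hmono : ∀ i x, V (i + 1) x ≤ V i x := fun i => by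
    refine le_of_opL_le (hgs i) (hinv i).1.contDiff (hC1 _ (hi i))
      (by rw [hVzero _ (hi i), (hinv i).1.map_zero]) fun x => ?_
    rw [heval _ (hi i)]
    exact (hinv i).2.2 x
  refine ⟨fun i x => ⟨hlower i x, hmono i x⟩, hgs, fun Vs us hVs hlimV hlimu => ?_⟩
  -- The index is shifted by one because u 0 is arbitrary and V 0 solves no policy evaluation
  -- equation.
  have hlimV' : ∀ x, Tendsto (fun i => V (i + 1) x) atTop (𝓝 (Vs x)) := fun x =>
    (hlimV x).comp (tendsto_add_atTop_nat 1)
  have hdense := dense_setOf_tendsto_prod_nhds (u := fun i => u (i + 1)) (v := us)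
    (fun i => (hinv i).2.1) fun x => (hlimu x).comp (tendsto_add_atTop_nat 1)
  set D : Set (State n) := {x | Tendsto (fun p : ℕ × State n => u (p.1 + 1) p.2)
    (atTop ×ˢ 𝓝 x) (𝓝 (us x))}
  have hD : ∀ x ∈ D, S.opH Vs x = 0 ∧ us x = S.improvedPolicy Vs x := fun x hx =>
    opH_eq_zero_of_tendsto (V := fun i => V (i + 1)) (u := fun i => u (i + 1))
      (fun i => hC1 _ (hi i)) hVs (fun i => heval _ (hi i)) (fun i => himp _ (hi i)) hlimV' hx
  have hH : ∀ x, S.opH Vs x = 0 := fun x =>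
    congrFun (Continuous.ext_on hdense (S.continuous_opH hVs) continuous_const
      fun x hx => (hD x hx).1) x
  have hVs0 : Vs 0 = 0 := tendsto_nhds_unique (hlimV' 0)
    (tendsto_const_nhds.congr fun i => (hVzero _ (hi i)).symm)
  have heq : Vs = Vo := funext fun x =>
    le_antisymm (le_of_opH_eq_zero hVo hHJB hVs hVs0 hH x)
      (ge_of_tendsto' (hlimV' x) fun i => hlower i x)
  refine ⟨heq, fun x hx => ?_⟩
  -- At a continuity point, u* is its own limit along the dense set D, where it equals a continuous
  -- policy.
  have : (𝓝[D] x).NeBot := mem_closure_iff_nhdsWithin_neBot.1 (hdense x)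
  rw [← heq]
  refine tendsto_nhds_unique (hx.mono_left nhdsWithin_le_nhds : Tendsto us (𝓝[D] x) _)
    ((((S.continuous_improvedPolicy hVs).tendsto x).mono_left nhdsWithin_le_nhds).congr' ?_)
  filter_upwards [self_mem_nhdsWithin] with y hy
  exact (hD y hy).2.symm
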